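/- Let $n\ge 0$ be an integer, write points of $\mathbb{R}^{n+1}$ as $(x,t)\in\mathbb{R}^n\times\mathbb{R}$, and let $H=\Delta_x-\partial_t$ be the heat operator, where $\Delta_x$ is the Laplacian in the $n$ variables $x$ (so $\Delta_x=0$ if $n=0$). Let $\Omega\subseteq\mathbb{R}^{n+1}$ be non-empty, open and bounded. For each $p\in(0,1)$ there exists a constant $c_p>0$, depending only on $n$, $\Omega$ and $p$, such that every $C^2$ function $u:\Omega\to\mathbb{R}$ with $Hu\ge 1$ on $\Omega$ satisfies $$\|u\|_{L^p(\Omega)}=\Big(\int_\Omega |u(x,t)|^p\,dx\,dt\Big)^{1/p}\ge c_p ,$$ where the left-hand side is allowed to be $+\infty$. -/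

import Mathlib

open MeasureTheory Set

open scoped Laplacian in
/-- The heat operator `H u = Δ_x u - ∂_t u` on functions of `(x, t) ∈ ℝⁿ × ℝ`, where `Δ_x` is the
Laplacian in the space variable `x` only. -/
noncomputable def heatOperator {n : ℕ} (u : EuclideanSpace ℝ (Fin n) × ℝ → ℝ)
    (z : EuclideanSpace ℝ (Fin n) × ℝ) : ℝ :=
  (Δ (fun y : EuclideanSpace ℝ (Fin n) => u (y, z.2))) z.1 - deriv (fun s : ℝ => u (z.1, s)) z.2

/-! Suppose the norm is tiny. Chebyshev's inequality then makes every set {|u| ≥ ε} small, and two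
facts about this smallness collide.

One is a sup bound (`exists_le_of_volume_abs_ge_le`): u ≤ κ on a smaller ball. It rests on a growth
lemma (`exists_volume_superlevel_ge`, rescaled in `exists_volume_superlevel_ge_of_ball`): if u
exceeds M at a point and stays below 2M on the ball of radius 2r around it, then {u > M/2} has
volume at least θ r^(n+2). Once the volume bound excludes this, u must double near each point where
it is large. Iterating with geometrically shrinking radii gives a bounded sequence of points along
which u is unbounded, against continuity.

The other (`exists_volume_abs_ge`) is that u ≤ κ and Hu ≥ 1 force {|u| ≥ κ} to have a definite
volume: test H(e^u) ≥ e^u against a bump function. If u were near 0 almost everywhere, e^u would be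
near 1 and its heat operator weakly near 0.

Both steps use exponentials of u, for two reasons. By `heatFlow_exp`, exponentiation preserves
subsolutions, and it makes large negative values harmless, so no lower bound on u is ever needed.
The growth lemma tests against a truncated heat kernel (`exists_test_function`). -/

/-! ### Directional derivatives and integration by parts. -/

theorem continuous_mul_of_tsupport_subset {V : Type*} [TopologicalSpace V] {f g : V → ℝ}
    {U : Set V} (hU : IsOpen U) (hf : Continuous f)
    (hfU : tsupport f ⊆ U) (hg : ContinuousOn g U) : Continuous fun z => f z * g z := by
  refine continuous_iff_continuousAt.2 fun y => ?_
  by_cases hy : y ∈ tsupport f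
  · exact hf.continuousAt.mul (hg.continuousAt (hU.mem_nhds (hfU hy)))
  · have : (fun z => f z * g z) =ᶠ[nhds y] fun _ => 0 := by
      filter_upwards [(isClosed_tsupport f).isOpen_compl.mem_nhds hy] with x hx
      simp [image_eq_zero_of_notMem_tsupport hx]
    exact continuousAt_const.congr this.symm

theorem integrable_mul_of_tsupport_subset {V : Type*} [TopologicalSpace V] [T2Space V]
    [MeasurableSpace V] [OpensMeasurableSpace V] {μ : Measure V} [IsFiniteMeasureOnCompacts μ]
    {f g : V → ℝ} {U : Set V} (hU : IsOpen U)
    (hf : Continuous f) (hfc : HasCompactSupport f) (hfU : tsupport f ⊆ U)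
    (hg : ContinuousOn g U) : Integrable (fun z => f z * g z) μ :=
  (continuous_mul_of_tsupport_subset hU hf hfU hg).integrable_of_hasCompactSupport hfc.mul_right

/-- The derivative of `f` in the fixed direction `w`. -/
noncomputable def dirDeriv {V : Type*} [NormedAddCommGroup V] [NormedSpace ℝ V] (w : V)
    (f : V → ℝ) (z : V) : ℝ :=
  fderiv ℝ f z w

section DirDeriv

variable {V : Type*} [NormedAddCommGroup V] [NormedSpace ℝ V] {w z : V} {f g : V → ℝ} {U : Set V}

theorem dirDeriv_mul (hf : DifferentiableAt ℝ f z) (hg : DifferentiableAt ℝ g z) :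
    dirDeriv w (fun y => f y * g y) z = f z * dirDeriv w g z + g z * dirDeriv w f z := by
  simp [dirDeriv, fderiv_fun_mul hf hg]

theorem dirDeriv_exp (hf : DifferentiableAt ℝ f z) :
    dirDeriv w (fun y => Real.exp (f y)) z = Real.exp (f z) * dirDeriv w f z := by
  simp [dirDeriv, fderiv_exp hf]

theorem dirDeriv_add (hf : DifferentiableAt ℝ f z) (hg : DifferentiableAt ℝ g z) :
    dirDeriv w (fun y => f y + g y) z = dirDeriv w f z + dirDeriv w g z := by
  simp [dirDeriv, fderiv_fun_add hf hg]

theorem dirDeriv_const_mul (c : ℝ) (hf : DifferentiableAt ℝ f z) :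
    dirDeriv w (fun y => c * f y) z = c * dirDeriv w f z := by
  simp [dirDeriv, fderiv_const_mul hf]

theorem dirDeriv_congr (h : f =ᶠ[nhds z] g) : dirDeriv w f z = dirDeriv w g z := by
  simp [dirDeriv, h.fderiv_eq]

theorem dirDeriv_eventuallyEq (h : f =ᶠ[nhds z] g) : dirDeriv w f =ᶠ[nhds z] dirDeriv w g := by
  filter_upwards [h.fderiv (𝕜 := ℝ)] with y hy
  simp [dirDeriv, hy]

theorem ContDiffAt.dirDeriv {m k : WithTop ℕ∞} (hf : ContDiffAt ℝ k f z) (hmk : m + 1 ≤ k) :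
    ContDiffAt ℝ m (dirDeriv w f) z :=
  (hf.fderiv_right hmk).clm_apply contDiffAt_const

theorem ContDiff.dirDeriv {m k : WithTop ℕ∞} (hf : ContDiff ℝ k f) (hmk : m + 1 ≤ k) :
    ContDiff ℝ m (dirDeriv w f) :=
  contDiff_iff_contDiffAt.2 fun _ => hf.contDiffAt.dirDeriv hmk

theorem ContDiffOn.dirDeriv {m k : WithTop ℕ∞} (hf : ContDiffOn ℝ k f U) (hU : IsOpen U)
    (hmk : m + 1 ≤ k) : ContDiffOn ℝ m (dirDeriv w f) U := fun _ hy =>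
  ((hf.contDiffAt (hU.mem_nhds hy)).dirDeriv hmk).contDiffWithinAt

theorem ContDiffAt.eventually_differentiableAt (hf : ContDiffAt ℝ 2 f z) :
    ∀ᶠ y in nhds z, DifferentiableAt ℝ f y := by
  filter_upwards [hf.eventually (by simp)] with y hy
  exact hy.differentiableAt (by simp)

theorem ContDiffAt.differentiableAt_dirDeriv (hf : ContDiffAt ℝ 2 f z) :
    DifferentiableAt ℝ (_root_.dirDeriv w f) z :=
  (hf.dirDeriv (m := 1) (by norm_num)).differentiableAt (by simp)

theorem dirDeriv_dirDeriv_mul (hf : ContDiffAt ℝ 2 f z) (hg : ContDiffAt ℝ 2 g z) :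
    dirDeriv w (dirDeriv w (fun y => f y * g y)) z =
      f z * dirDeriv w (dirDeriv w g) z + g z * dirDeriv w (dirDeriv w f) z +
        2 * (dirDeriv w f z * dirDeriv w g z) := by
  have h1 : dirDeriv w (fun y => f y * g y) =ᶠ[nhds z]
      fun y => f y * dirDeriv w g y + g y * dirDeriv w f y := by
    filter_upwards [hf.eventually_differentiableAt, hg.eventually_differentiableAt] with y h h'
    exact dirDeriv_mul h h'
  have hf' := hf.differentiableAt (by simp)
  have hg' := hg.differentiableAt (by simp)
  have hf'' := hf.differentiableAt_dirDeriv (w := w)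
  have hg'' := hg.differentiableAt_dirDeriv (w := w)
  rw [dirDeriv_congr h1, dirDeriv_add (hf'.fun_mul hg'') (hg'.fun_mul hf''), dirDeriv_mul hf' hg'',
    dirDeriv_mul hg' hf'']
  ring

theorem dirDeriv_dirDeriv_exp (hf : ContDiffAt ℝ 2 f z) :
    dirDeriv w (dirDeriv w (fun y => Real.exp (f y))) z =
      Real.exp (f z) * (dirDeriv w (dirDeriv w f) z + dirDeriv w f z ^ 2) := by
  have h1 : dirDeriv w (fun y => Real.exp (f y)) =ᶠ[nhds z]
      fun y => Real.exp (f y) * dirDeriv w f y := by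
    filter_upwards [hf.eventually_differentiableAt] with y h
    exact dirDeriv_exp h
  have hf' := hf.differentiableAt (by simp)
  rw [dirDeriv_congr h1, dirDeriv_mul hf'.exp hf.differentiableAt_dirDeriv, dirDeriv_exp hf']
  ring

theorem dirDeriv_dirDeriv_const_mul (c : ℝ) (hf : ContDiffAt ℝ 2 f z) :
    dirDeriv w (dirDeriv w (fun y => c * f y)) z = c * dirDeriv w (dirDeriv w f) z := by
  have h1 : dirDeriv w (fun y => c * f y) =ᶠ[nhds z] fun y => c * dirDeriv w f y := by
    filter_upwards [hf.eventually_differentiableAt] with y h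
    exact dirDeriv_const_mul c h
  rw [dirDeriv_congr h1, dirDeriv_const_mul c hf.differentiableAt_dirDeriv]

theorem dirDeriv_smul_dir (c : ℝ) : dirDeriv (c • w) f z = c * dirDeriv w f z := by
  simp [dirDeriv]

theorem dirDeriv_comp_affine (L : V →L[ℝ] V) (a : V) (hf : DifferentiableAt ℝ f (a + L z)) :
    dirDeriv w (fun y => f (a + L y)) z = dirDeriv (L w) f (a + L z) := by
  have h : HasFDerivAt (fun y => f (a + L y)) ((fderiv ℝ f (a + L z)).comp L) z :=
    hf.hasFDerivAt.comp z (L.hasFDerivAt.const_add a)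
  simp [dirDeriv, h.fderiv]

theorem dirDeriv_dirDeriv_comp_affine (L : V →L[ℝ] V) (a : V)
    (hf : ContDiffAt ℝ 2 f (a + L z)) :
    dirDeriv w (dirDeriv w (fun y => f (a + L y))) z =
      dirDeriv (L w) (dirDeriv (L w) f) (a + L z) := by
  have hc : ContinuousAt (fun y => a + L y) z := by fun_prop
  have h1 : dirDeriv w (fun y => f (a + L y)) =ᶠ[nhds z]
      fun y => dirDeriv (L w) f (a + L y) := by
    filter_upwards [hc.eventually hf.eventually_differentiableAt] with y h
    exact dirDeriv_comp_affine L a h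
  rw [dirDeriv_congr h1, dirDeriv_comp_affine L a hf.differentiableAt_dirDeriv]

theorem tsupport_dirDeriv_subset : tsupport (dirDeriv w f) ⊆ tsupport f :=
  tsupport_fderiv_apply_subset ℝ w

theorem dirDeriv_eq_zero_of_notMem_tsupport (hz : z ∉ tsupport f) : dirDeriv w f z = 0 :=
  image_eq_zero_of_notMem_tsupport fun h => hz (tsupport_dirDeriv_subset h)

variable [MeasurableSpace V] [BorelSpace V] {μ : Measure V} [FiniteDimensional ℝ V] [μ.IsAddHaarMeasure]

/-- Regularity of `g` is needed only on `U`, since `f` vanishes near every point outside it; thus u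
never has to be extended beyond Ω. -/
theorem integral_mul_dirDeriv (hU : IsOpen U) (hf : ContDiff ℝ 1 f)
    (hfc : HasCompactSupport f) (hfU : tsupport f ⊆ U) (hg : ContDiffOn ℝ 1 g U) :
    ∫ z, f z * dirDeriv w g z ∂μ = -∫ z, dirDeriv w f z * g z ∂μ := by
  refine integral_mul_fderiv_eq_neg_fderiv_mul_of_integrable ?_ ?_ ?_
    (fun z _ => hf.differentiable (by simp) z)
    (fun z hz => (hg.contDiffAt (hU.mem_nhds (hfU hz))).differentiableAt (by simp))
  · exact integrable_mul_of_tsupport_subset hU (hf.dirDeriv (m := 0) (by simp)).continuous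
      (hfc.mono' (subset_closure.trans tsupport_dirDeriv_subset))
      (tsupport_dirDeriv_subset.trans hfU) hg.continuousOn
  · exact integrable_mul_of_tsupport_subset hU hf.continuous hfc hfU
      (hg.dirDeriv hU (m := 0) (by simp)).continuousOn
  · exact integrable_mul_of_tsupport_subset hU hf.continuous hfc hfU hg.continuousOn

theorem integral_mul_dirDeriv_dirDeriv (hU : IsOpen U) (hf : ContDiff ℝ 2 f)
    (hfc : HasCompactSupport f) (hfU : tsupport f ⊆ U) (hg : ContDiffOn ℝ 2 g U) :
    ∫ z, f z * dirDeriv w (dirDeriv w g) z ∂μ = ∫ z, dirDeriv w (dirDeriv w f) z * g z ∂μ := by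
  rw [integral_mul_dirDeriv hU (hf.of_le (by norm_num)) hfc hfU (hg.dirDeriv hU (by norm_num)),
    integral_mul_dirDeriv hU (hf.dirDeriv (by norm_num))
      (hfc.mono' (subset_closure.trans tsupport_dirDeriv_subset))
      (tsupport_dirDeriv_subset.trans hfU) (hg.of_le (by norm_num)), neg_neg]

end DirDeriv

/-! ### The heat operator, its adjoint and parabolic scaling. -/

/-- The `i`-th spatial coordinate direction in `ℝⁿ × ℝ`. -/
noncomputable def spaceDir {n : ℕ} (i : Fin n) : EuclideanSpace ℝ (Fin n) × ℝ :=
  (EuclideanSpace.single i 1, 0)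

/-- The time direction in `ℝⁿ × ℝ`. -/
noncomputable def timeDir (n : ℕ) : EuclideanSpace ℝ (Fin n) × ℝ := (0, 1)

/-- The operator `Δ_x + σ ∂_t`: the heat operator for `σ = -1`, its adjoint for `σ = 1`. -/
noncomputable def heatFlow {n : ℕ} (σ : ℝ) (f : EuclideanSpace ℝ (Fin n) × ℝ → ℝ)
    (z : EuclideanSpace ℝ (Fin n) × ℝ) : ℝ :=
  ∑ i, dirDeriv (spaceDir i) (dirDeriv (spaceDir i) f) z + σ * dirDeriv (timeDir n) f z

/-- The inner product of the spatial gradients of two functions. -/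
noncomputable def gradInner {n : ℕ} (f g : EuclideanSpace ℝ (Fin n) × ℝ → ℝ)
    (z : EuclideanSpace ℝ (Fin n) × ℝ) : ℝ :=
  ∑ i, dirDeriv (spaceDir i) f z * dirDeriv (spaceDir i) g z

/-- The parabolic dilation `(x, s) ↦ (r x, -r² s)`, reversing time. -/
noncomputable def parabolicScaling (n : ℕ) (r : ℝ) :
    EuclideanSpace ℝ (Fin n) × ℝ →L[ℝ] EuclideanSpace ℝ (Fin n) × ℝ :=
  (r • ContinuousLinearMap.id ℝ _).prodMap ((-r ^ 2) • ContinuousLinearMap.id ℝ ℝ)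

theorem parabolicScaling_apply {n : ℕ} (r : ℝ) (z : EuclideanSpace ℝ (Fin n) × ℝ) :
    parabolicScaling n r z = (r • z.1, -r ^ 2 * z.2) := rfl

instance isAddHaarMeasure_volume_euclideanSpace_prod_real (n : ℕ) :
    (volume : Measure (EuclideanSpace ℝ (Fin n) × ℝ)).IsAddHaarMeasure :=
  inferInstanceAs ((volume.prod volume :
    Measure (EuclideanSpace ℝ (Fin n) × ℝ)).IsAddHaarMeasure)

section HeatFlow

variable {n : ℕ} {σ : ℝ} {f g : EuclideanSpace ℝ (Fin n) × ℝ → ℝ}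
  {U : Set (EuclideanSpace ℝ (Fin n) × ℝ)} {z : EuclideanSpace ℝ (Fin n) × ℝ}

theorem laplacian_slice_eq_sum_dirDeriv (hf : ContDiffAt ℝ 2 f z) :
    Laplacian.laplacian (fun y : EuclideanSpace ℝ (Fin n) => f (y, z.2)) z.1 =
      ∑ i, dirDeriv (spaceDir i) (dirDeriv (spaceDir i) f) z := by
  have hslice : ∀ (h : EuclideanSpace ℝ (Fin n) × ℝ → ℝ) (y : EuclideanSpace ℝ (Fin n))
      (v : EuclideanSpace ℝ (Fin n)), DifferentiableAt ℝ h (y, z.2) →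
      fderiv ℝ (fun y => h (y, z.2)) y v = fderiv ℝ h (y, z.2) (v, 0) := by
    intro h y v hh
    have := hh.hasFDerivAt.comp y (hasFDerivAt_prodMk_left (𝕜 := ℝ) y z.2)
    have h2 := this.fderiv
    simp only [Function.comp_def] at h2
    rw [h2]; simp
  have hc : ContinuousAt (fun y : EuclideanSpace ℝ (Fin n) => (y, z.2)) z.1 := by fun_prop
  have hz : ContDiffAt ℝ 2 f (z.1, z.2) := hf
  have hslice2 : ContDiffAt ℝ 2 (fun y : EuclideanSpace ℝ (Fin n) => f (y, z.2)) z.1 :=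
    hz.comp z.1 (contDiffAt_id.prodMk contDiffAt_const)
  rw [InnerProductSpace.laplacian_eq_iteratedFDeriv_orthonormalBasis _
    (EuclideanSpace.basisFun (Fin n) ℝ)]
  refine Finset.sum_congr rfl fun i _ => ?_
  rw [iteratedFDeriv_two_apply]
  simp only [EuclideanSpace.basisFun_apply, Matrix.cons_val_zero, Matrix.cons_val_one]
  set v : EuclideanSpace ℝ (Fin n) := EuclideanSpace.single i 1
  have hd : DifferentiableAt ℝ (fderiv ℝ fun y : EuclideanSpace ℝ (Fin n) => f (y, z.2)) z.1 :=
    (hslice2.fderiv_right (m := 1) (by norm_num)).differentiableAt (by simp)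
  have h1 : fderiv ℝ (fderiv ℝ fun y : EuclideanSpace ℝ (Fin n) => f (y, z.2)) z.1 v v =
      fderiv ℝ (fun x => fderiv ℝ (fun y : EuclideanSpace ℝ (Fin n) => f (y, z.2)) x v) z.1 v := by
    rw [fderiv_clm_apply hd (differentiableAt_const _)]
    simp
  have h2 : (fun x => fderiv ℝ (fun y : EuclideanSpace ℝ (Fin n) => f (y, z.2)) x v) =ᶠ[nhds z.1]
      fun x => dirDeriv (spaceDir i) f (x, z.2) := by
    filter_upwards [hc.eventually hz.eventually_differentiableAt] with x hx
    exact hslice f x v hx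
  rw [h1, h2.fderiv_eq, hslice _ _ _ hz.differentiableAt_dirDeriv]
  rfl

theorem heatOperator_eq_heatFlow (hf : ContDiffAt ℝ 2 f z) :
    heatOperator f z = heatFlow (-1) f z := by
  have h : HasFDerivAt (fun s : ℝ => f (z.1, s)) _ z.2 :=
    HasFDerivAt.comp z.2 (g := f) (hf.differentiableAt (by simp)).hasFDerivAt
      (hasFDerivAt_prodMk_right (𝕜 := ℝ) z.1 z.2)
  rw [heatOperator, heatFlow, laplacian_slice_eq_sum_dirDeriv hf, ← fderiv_apply_one_eq_deriv,
    h.fderiv]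
  simp [dirDeriv, timeDir, sub_eq_add_neg]

theorem heatFlow_mul (hf : ContDiffAt ℝ 2 f z) (hg : ContDiffAt ℝ 2 g z) :
    heatFlow σ (fun y => f y * g y) z =
      f z * heatFlow σ g z + g z * heatFlow σ f z + 2 * gradInner f g z := by
  simp only [heatFlow, gradInner, dirDeriv_dirDeriv_mul hf hg,
    dirDeriv_mul (hf.differentiableAt (by simp)) (hg.differentiableAt (by simp)),
    Finset.sum_add_distrib, ← Finset.mul_sum]
  ring

/-- The squared gradient enters with a good sign whatever `σ` is, so exponentials of subsolutions
are subsolutions for both operators. -/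
theorem heatFlow_exp (hf : ContDiffAt ℝ 2 f z) :
    heatFlow σ (fun y => Real.exp (f y)) z =
      Real.exp (f z) * (heatFlow σ f z + gradInner f f z) := by
  simp only [heatFlow, gradInner, dirDeriv_dirDeriv_exp hf,
    dirDeriv_exp (hf.differentiableAt (by simp)), ← Finset.mul_sum, Finset.sum_add_distrib, ← sq]
  ring

theorem gradInner_self_nonneg : 0 ≤ gradInner f f z :=
  Finset.sum_nonneg fun _ _ => mul_self_nonneg _

theorem heatFlow_const_mul (c : ℝ) (hf : ContDiffAt ℝ 2 f z) :
    heatFlow σ (fun y => c * f y) z = c * heatFlow σ f z := by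
  simp only [heatFlow, dirDeriv_dirDeriv_const_mul c hf,
    dirDeriv_const_mul c (hf.differentiableAt (by simp)), ← Finset.mul_sum]
  ring

theorem heatFlow_congr (h : f =ᶠ[nhds z] g) : heatFlow σ f z = heatFlow σ g z := by
  simp only [heatFlow, dirDeriv_congr h, dirDeriv_congr (dirDeriv_eventuallyEq h)]

theorem heatFlow_const (c : ℝ) : heatFlow σ (fun _ : EuclideanSpace ℝ (Fin n) × ℝ => c) z = 0 := by
  have h : ∀ w, dirDeriv w (fun _ : EuclideanSpace ℝ (Fin n) × ℝ => c) = fun _ => 0 := by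
    intro w; ext y; simp [dirDeriv]
  have h' : ∀ w, dirDeriv w (fun _ : EuclideanSpace ℝ (Fin n) × ℝ => (0 : ℝ)) z = 0 := by
    intro w; simp [dirDeriv]
  simp [heatFlow, h, h']

theorem heatFlow_eq_zero_of_notMem_tsupport (hz : z ∉ tsupport f) : heatFlow σ f z = 0 := by
  rw [heatFlow_congr (notMem_tsupport_iff_eventuallyEq.1 hz)]
  exact heatFlow_const 0

theorem ContDiff.continuous_heatFlow (hf : ContDiff ℝ 2 f) : Continuous (heatFlow σ f) := by
  refine .add (continuous_finsetSum _ fun i _ => ?_) (continuous_const.mul ?_)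
  · exact ((hf.dirDeriv (m := 1) (by norm_num)).dirDeriv (m := 0) (by norm_num)).continuous
  · exact (hf.dirDeriv (m := 1) (by norm_num)).continuous

theorem ContDiffOn.continuousOn_heatFlow (hf : ContDiffOn ℝ 2 f U) (hU : IsOpen U) :
    ContinuousOn (heatFlow σ f) U := by
  refine .add (continuousOn_finsetSum _ fun i _ => ?_) (continuousOn_const.mul ?_)
  · exact ((hf.dirDeriv hU (m := 1) (by norm_num)).dirDeriv hU (m := 0) (by norm_num)).continuousOn
  · exact (hf.dirDeriv hU (m := 1) (by norm_num)).continuousOn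

theorem integral_mul_heatFlow (hU : IsOpen U) (hf : ContDiff ℝ 2 f)
    (hfc : HasCompactSupport f) (hfU : tsupport f ⊆ U) (hg : ContDiffOn ℝ 2 g U) :
    ∫ z, f z * heatFlow σ g z = ∫ z, heatFlow (-σ) f z * g z := by
  have hf1 : ContDiff ℝ 1 f := hf.of_le (by norm_num)
  have hg1 : ContDiffOn ℝ 1 g U := hg.of_le (by norm_num)
  have hsub : ∀ {h : EuclideanSpace ℝ (Fin n) × ℝ → ℝ} w, HasCompactSupport h →
      HasCompactSupport (dirDeriv w h) := fun w hh =>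
    hh.mono' (subset_closure.trans tsupport_dirDeriv_subset)
  have hI := fun (i : Fin n) => integral_mul_dirDeriv_dirDeriv (w := spaceDir i)
    (μ := volume) hU hf hfc hfU hg
  have hT := integral_mul_dirDeriv (w := timeDir n) (μ := volume) hU hf1 hfc hfU hg1
  have i1 : ∀ i : Fin n, Integrable
      (fun z => f z * dirDeriv (spaceDir i) (dirDeriv (spaceDir i) g) z) := fun i =>
    integrable_mul_of_tsupport_subset hU hf.continuous hfc hfU
      ((hg.dirDeriv hU (m := 1) (by norm_num)).dirDeriv hU (m := 0) (by norm_num)).continuousOn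
  have i2 : Integrable (fun z => f z * dirDeriv (timeDir n) g z) :=
    integrable_mul_of_tsupport_subset hU hf.continuous hfc hfU
      (hg.dirDeriv hU (m := 1) (by norm_num)).continuousOn
  have i3 : ∀ i : Fin n, Integrable
      (fun z => dirDeriv (spaceDir i) (dirDeriv (spaceDir i) f) z * g z) := fun i =>
    integrable_mul_of_tsupport_subset hU
      ((hf.dirDeriv (m := 1) (by norm_num)).dirDeriv (m := 0) (by norm_num)).continuous
      (hsub _ (hsub _ hfc)) ((tsupport_dirDeriv_subset.trans tsupport_dirDeriv_subset).trans hfU)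
      hg.continuousOn
  have i4 : Integrable (fun z => dirDeriv (timeDir n) f z * g z) :=
    integrable_mul_of_tsupport_subset hU (hf.dirDeriv (m := 1) (by norm_num)).continuous
      (hsub _ hfc) (tsupport_dirDeriv_subset.trans hfU) hg.continuousOn
  have e1 : (fun z => f z * heatFlow σ g z) = fun z =>
      (∑ i, f z * dirDeriv (spaceDir i) (dirDeriv (spaceDir i) g) z) +
        σ * (f z * dirDeriv (timeDir n) g z) := by
    ext z; rw [heatFlow, mul_add, Finset.mul_sum]; ring
  have e2 : (fun z => heatFlow (-σ) f z * g z) = fun z =>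
      (∑ i, dirDeriv (spaceDir i) (dirDeriv (spaceDir i) f) z * g z) +
        (-σ) * (dirDeriv (timeDir n) f z * g z) := by
    ext z; rw [heatFlow, add_mul, Finset.sum_mul]; ring
  rw [e1, e2, integral_add (integrable_finsetSum _ fun i _ => i1 i) (i2.const_mul σ),
    integral_add (integrable_finsetSum _ fun i _ => i3 i) (i4.const_mul (-σ)),
    integral_finsetSum _ fun i _ => i1 i, integral_finsetSum _ fun i _ => i3 i,
    integral_const_mul, integral_const_mul, hT, Finset.sum_congr rfl fun i _ => hI i]
  ring

/-- Reversing time exchanges the heat operator with its adjoint, so that subsolutions can be tested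
against the forward heat kernel with pole at the origin. -/
theorem heatFlow_comp_parabolicScaling (r : ℝ) (a : EuclideanSpace ℝ (Fin n) × ℝ)
    (hf : ContDiffAt ℝ 2 f (a + parabolicScaling n r z)) :
    heatFlow 1 (fun y => f (a + parabolicScaling n r y)) z =
      r ^ 2 * heatFlow (-1) f (a + parabolicScaling n r z) := by
  have hs : ∀ i : Fin n, parabolicScaling n r (spaceDir i) = r • spaceDir i := by
    intro i; simp [parabolicScaling, spaceDir]
  have ht : parabolicScaling n r (timeDir n) = (-r ^ 2) • timeDir n := by
    simp [parabolicScaling, timeDir]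
  have hd : ∀ i : Fin n, dirDeriv (r • spaceDir i) f = fun y => r * dirDeriv (spaceDir i) f y := by
    intro i; ext y; exact dirDeriv_smul_dir r
  simp only [heatFlow, dirDeriv_dirDeriv_comp_affine _ _ hf,
    dirDeriv_comp_affine _ _ (hf.differentiableAt (by simp)), hs, ht, hd, dirDeriv_smul_dir,
    dirDeriv_const_mul r hf.differentiableAt_dirDeriv, Finset.mul_sum, mul_add]
  congr 1
  · exact Finset.sum_congr rfl fun i _ => by ring
  · ring

theorem volume_image_parabolicScaling (r : ℝ) (a : EuclideanSpace ℝ (Fin n) × ℝ)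
    (s : Set (EuclideanSpace ℝ (Fin n) × ℝ)) :
    volume ((fun z => a + parabolicScaling n r z) '' s) =
      ENNReal.ofReal (|r| ^ (n + 2)) * volume s := by
  have h1 : (fun z => a + parabolicScaling n r z) '' s =
      (fun z => a + z) '' (parabolicScaling n r '' s) := by
    rw [image_image]
  have hdet : LinearMap.det ((parabolicScaling n r : EuclideanSpace ℝ (Fin n) × ℝ →L[ℝ] _) :
      EuclideanSpace ℝ (Fin n) × ℝ →ₗ[ℝ] EuclideanSpace ℝ (Fin n) × ℝ) = r ^ n * (-r ^ 2) := by
    have : ((parabolicScaling n r : EuclideanSpace ℝ (Fin n) × ℝ →L[ℝ] _) :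
      EuclideanSpace ℝ (Fin n) × ℝ →ₗ[ℝ] EuclideanSpace ℝ (Fin n) × ℝ) =
        LinearMap.prodMap (r • LinearMap.id) ((-r ^ 2) • LinearMap.id) := rfl
    rw [this, LinearMap.det_prodMap, LinearMap.det_smul, LinearMap.det_smul]
    simp
  rw [h1, image_add_left, measure_preimage_add]
  have := Measure.addHaar_image_linearMap (volume : Measure (EuclideanSpace ℝ (Fin n) × ℝ))
    (parabolicScaling n r : EuclideanSpace ℝ (Fin n) × ℝ →ₗ[ℝ] EuclideanSpace ℝ (Fin n) × ℝ) s
  rw [hdet] at this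
  rw [pow_add, ← abs_pow, ← abs_pow, ← abs_mul]
  simpa [abs_mul] using this

theorem dist_add_parabolicScaling_le {r : ℝ} (hr : 0 ≤ r) (hr1 : r ≤ 1)
    (a z : EuclideanSpace ℝ (Fin n) × ℝ) : dist (a + parabolicScaling n r z) a ≤ r * ‖z‖ := by
  rw [dist_eq_norm, add_sub_cancel_left, parabolicScaling_apply, Prod.norm_def]
  refine max_le ?_ ?_
  · rw [norm_smul, Real.norm_eq_abs, abs_of_nonneg hr]
    exact mul_le_mul_of_nonneg_left (norm_fst_le z) hr
  · rw [norm_mul, norm_neg, norm_pow, Real.norm_eq_abs, abs_of_nonneg hr]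
    have hrr : r ^ 2 ≤ r := by nlinarith
    exact mul_le_mul hrr (norm_snd_le z) (norm_nonneg _) hr

end HeatFlow

/-! ### The heat kernel. -/

/-- The logarithm of the unnormalised heat kernel `s^(-n/2) exp(-|x|²/(4s))`. -/
noncomputable def logHeatKernel (n : ℕ) (z : EuclideanSpace ℝ (Fin n) × ℝ) : ℝ :=
  -(n / 2 : ℝ) * Real.log z.2 - ‖z.1‖ ^ 2 * (4 * z.2)⁻¹

section HeatKernel

variable {n : ℕ} {z : EuclideanSpace ℝ (Fin n) × ℝ}

theorem contDiffAt_logHeatKernel (hz : 0 < z.2) : ContDiffAt ℝ 2 (logHeatKernel n) z := by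
  have h1 : ContDiffAt ℝ 2 (fun y : EuclideanSpace ℝ (Fin n) × ℝ => y.2) z := contDiffAt_snd
  have h2 : ContDiffAt ℝ 2 (fun y : EuclideanSpace ℝ (Fin n) × ℝ => ‖y.1‖ ^ 2) z :=
    contDiffAt_fst.norm_sq ℝ
  exact (contDiffAt_const.mul (h1.log hz.ne')).sub
    (h2.mul ((contDiffAt_const.mul h1).inv (by positivity)))

theorem hasFDerivAt_logHeatKernel (hz : 0 < z.2) :
    HasFDerivAt (logHeatKernel n)
      ((-(n / 2 : ℝ)) • (z.2⁻¹ • ContinuousLinearMap.snd ℝ (EuclideanSpace ℝ (Fin n)) ℝ) -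
        (‖z.1‖ ^ 2 • ((-((4 * z.2) ^ 2)⁻¹) • ((4 : ℝ) •
          ContinuousLinearMap.snd ℝ (EuclideanSpace ℝ (Fin n)) ℝ)) +
        (4 * z.2)⁻¹ • ((2 • innerSL ℝ z.1).comp
          (ContinuousLinearMap.fst ℝ (EuclideanSpace ℝ (Fin n)) ℝ)))) z := by
  have h1 : HasFDerivAt (fun y : EuclideanSpace ℝ (Fin n) × ℝ => y.2)
    (ContinuousLinearMap.snd ℝ (EuclideanSpace ℝ (Fin n)) ℝ) z := hasFDerivAt_snd
  have h2 : HasFDerivAt (fun y : EuclideanSpace ℝ (Fin n) × ℝ => ‖y.1‖ ^ 2)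
      ((2 • innerSL ℝ z.1).comp (ContinuousLinearMap.fst ℝ (EuclideanSpace ℝ (Fin n)) ℝ)) z :=
    HasFDerivAt.comp z (hasStrictFDerivAt_norm_sq z.1).hasFDerivAt hasFDerivAt_fst
  have h3 := (hasDerivAt_inv (x := 4 * z.2) (by positivity)).comp_hasFDerivAt z (h1.const_mul 4)
  exact ((h1.log hz.ne').const_mul _).sub (h2.mul h3)

theorem dirDeriv_spaceDir_logHeatKernel (hz : 0 < z.2) (i : Fin n) :
    dirDeriv (spaceDir i) (logHeatKernel n) z = -(z.1 i * (2 * z.2)⁻¹) := by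
  rw [dirDeriv, (hasFDerivAt_logHeatKernel hz).fderiv]
  simp [spaceDir, EuclideanSpace.inner_single_right]
  ring

theorem dirDeriv_timeDir_logHeatKernel (hz : 0 < z.2) :
    dirDeriv (timeDir n) (logHeatKernel n) z =
      -(n / 2 : ℝ) * z.2⁻¹ + ‖z.1‖ ^ 2 * (4 * z.2 ^ 2)⁻¹ := by
  rw [dirDeriv, (hasFDerivAt_logHeatKernel hz).fderiv]
  simp [timeDir]
  left
  field_simp

theorem eventually_snd_pos (hz : 0 < z.2) :
    ∀ᶠ y : EuclideanSpace ℝ (Fin n) × ℝ in nhds z, 0 < y.2 :=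
  continuous_snd.continuousAt.eventually (lt_mem_nhds hz)

theorem dirDeriv_dirDeriv_spaceDir_logHeatKernel (hz : 0 < z.2) (i : Fin n) :
    dirDeriv (spaceDir i) (dirDeriv (spaceDir i) (logHeatKernel n)) z = -(2 * z.2)⁻¹ := by
  have h : dirDeriv (spaceDir i) (logHeatKernel n) =ᶠ[nhds z]
      fun y => (fun y : EuclideanSpace ℝ (Fin n) × ℝ => y.1 i) y *
        (fun y : EuclideanSpace ℝ (Fin n) × ℝ => -(2 * y.2)⁻¹) y := by
    filter_upwards [eventually_snd_pos hz] with y hy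
    rw [dirDeriv_spaceDir_logHeatKernel hy i]
    ring
  have h1 : HasFDerivAt (fun y : EuclideanSpace ℝ (Fin n) × ℝ => y.1 i)
      ((EuclideanSpace.proj i : EuclideanSpace ℝ (Fin n) →L[ℝ] ℝ).comp
        (ContinuousLinearMap.fst ℝ (EuclideanSpace ℝ (Fin n)) ℝ)) z :=
    ((EuclideanSpace.proj i : EuclideanSpace ℝ (Fin n) →L[ℝ] ℝ).comp
        (ContinuousLinearMap.fst ℝ (EuclideanSpace ℝ (Fin n)) ℝ)).hasFDerivAt
  have h2 : HasFDerivAt (fun y : EuclideanSpace ℝ (Fin n) × ℝ => -(2 * y.2)⁻¹) _ z :=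
    ((hasDerivAt_inv (x := 2 * z.2) (by positivity)).comp_hasFDerivAt z
      ((hasFDerivAt_snd (𝕜 := ℝ) (p := z)).const_mul 2)).neg
  rw [dirDeriv_congr h, dirDeriv_mul h1.differentiableAt h2.differentiableAt, dirDeriv, dirDeriv,
    h1.fderiv, h2.fderiv]
  simp [spaceDir]

theorem heatFlow_exp_logHeatKernel (hz : 0 < z.2) :
    heatFlow (-1) (fun y => Real.exp (logHeatKernel n y)) z = 0 := by
  rw [heatFlow_exp (contDiffAt_logHeatKernel hz)]
  refine mul_eq_zero_of_right _ ?_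
  simp only [heatFlow, gradInner, dirDeriv_dirDeriv_spaceDir_logHeatKernel hz,
    dirDeriv_spaceDir_logHeatKernel hz, dirDeriv_timeDir_logHeatKernel hz]
  have : ∑ i, -(z.1 i * (2 * z.2)⁻¹) * -(z.1 i * (2 * z.2)⁻¹) =
      ‖z.1‖ ^ 2 * (4 * z.2 ^ 2)⁻¹ := by
    rw [EuclideanSpace.norm_sq_eq, Finset.sum_mul]
    refine Finset.sum_congr rfl fun i _ => ?_
    rw [Real.norm_eq_abs, sq_abs]
    field_simp
    norm_num
  rw [this]
  simp
  field_simp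
  ring

/-- Away from the origin, small time forces |x| ≥ 1/2, and the Gaussian factor beats the power
s^(-n/2-1). This controls the cutoff error, whose worst term is kernel/s. -/
theorem exp_logHeatKernel_div_le (hz : 0 < z.2) (hz2 : 1 / 2 ≤ ‖z‖) :
    Real.exp (logHeatKernel n z) * z.2⁻¹ ≤
      Real.exp ((n / 2 + 1 : ℝ) * Real.log (16 * (n / 2 + 1 : ℝ))) := by
  have hk : (1 : ℝ) ≤ n / 2 + 1 := by
    have : (0 : ℝ) ≤ n / 2 := by positivity
    linarith
  set k : ℝ := n / 2 + 1 with hkdef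
  have hk' : (n / 2 : ℝ) = k - 1 := by rw [hkdef]; ring
  have hs : z.2⁻¹ = Real.exp (-Real.log z.2) := by rw [Real.exp_neg, Real.exp_log hz]
  rw [hs, ← Real.exp_add, Real.exp_le_exp, logHeatKernel, hk']
  rcases le_or_gt (1 / 2) z.2 with h | h
  · have h1 : Real.log (1 / 16) ≤ Real.log z.2 := Real.log_le_log (by norm_num) (by linarith)
    have h2 : Real.log 16 ≤ Real.log (16 * k) := Real.log_le_log (by norm_num) (by linarith)
    rw [one_div, Real.log_inv] at h1
    have h3 : k * -Real.log z.2 ≤ k * Real.log (16 * k) :=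
      mul_le_mul_of_nonneg_left (by linarith) (by linarith)
    have h4 : 0 ≤ ‖z.1‖ ^ 2 * (4 * z.2)⁻¹ := by positivity
    linarith
  · have hx : 1 / 2 ≤ ‖z.1‖ := by
      rw [Prod.norm_def, le_max_iff, Real.norm_eq_abs, abs_of_pos hz] at hz2
      exact hz2.resolve_right (not_le.2 h)
    -- The factor 16k is tuned so that k/(16ks) = (1/2)²/(4s), which the Gaussian exponent absorbs
    -- exactly.
    have h1 := Real.log_le_sub_one_of_pos (x := (16 * k * z.2)⁻¹) (by positivity)
    rw [Real.log_inv, Real.log_mul (by positivity) hz.ne'] at h1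
    have h2 : k * -Real.log z.2 ≤ k * (Real.log (16 * k) + (16 * k * z.2)⁻¹) :=
      mul_le_mul_of_nonneg_left (by linarith) (by linarith)
    have h3 : k * (16 * k * z.2)⁻¹ = (1 / 2) ^ 2 * (4 * z.2)⁻¹ := by field_simp; norm_num
    have h4 : (1 / 2 : ℝ) ^ 2 * (4 * z.2)⁻¹ ≤ ‖z.1‖ ^ 2 * (4 * z.2)⁻¹ := by gcongr
    linarith

end HeatKernel

/-! ### A truncated heat kernel as test function. -/

section TestFunction

variable {n : ℕ}

/-- The kernel solves the heat equation, so only derivatives of the cutoffs survive: a bounded error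
from `ψ` and the term in q', negative for increasing `q`. -/
theorem heatFlow_cutoff_mul_heatKernel {ψ : EuclideanSpace ℝ (Fin n) × ℝ → ℝ} {q : ℝ → ℝ}
    (hψ : ContDiff ℝ 2 ψ) (hq : ContDiff ℝ 2 q) {z : EuclideanSpace ℝ (Fin n) × ℝ}
    (hz : 0 < z.2) :
    heatFlow (-1) (fun y => ψ y * q y.2 * Real.exp (logHeatKernel n y)) z =
      q z.2 * (Real.exp (logHeatKernel n z) * (heatFlow (-1) ψ z -
        (∑ i, dirDeriv (spaceDir i) ψ z * z.1 i) * z.2⁻¹)) -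
      ψ z * Real.exp (logHeatKernel n z) * deriv q z.2 := by
  have hg := contDiffAt_logHeatKernel hz
  have hqz : ContDiff ℝ 2 (fun y : EuclideanSpace ℝ (Fin n) × ℝ => q y.2) :=
    hq.comp contDiff_snd
  have hqd : ∀ w y, dirDeriv w (fun y : EuclideanSpace ℝ (Fin n) × ℝ => q y.2) y =
      w.2 * deriv q y.2 := by
    intro w y
    have := ((hq.differentiable (by simp)) y.2).hasDerivAt.comp_hasFDerivAt y
      (hasFDerivAt_snd (𝕜 := ℝ) (p := y))
    have h2 := this.fderiv
    simp only [Function.comp_def] at h2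
    rw [dirDeriv, h2]
    simp [mul_comm]
  have hq0 : ∀ i : Fin n, dirDeriv (spaceDir i)
      (fun y : EuclideanSpace ℝ (Fin n) × ℝ => q y.2) = fun _ => 0 := by
    intro i; ext y; rw [hqd]; simp [spaceDir]
  have hqflow : heatFlow (-1) (fun y : EuclideanSpace ℝ (Fin n) × ℝ => q y.2) z =
      -deriv q z.2 := by
    have h0 : ∀ w, dirDeriv w (fun _ : EuclideanSpace ℝ (Fin n) × ℝ => (0 : ℝ)) z = 0 := by
      intro w; simp [dirDeriv]
    simp [heatFlow, hq0, hqd, h0, timeDir]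
  have hgrad : gradInner ψ (fun y : EuclideanSpace ℝ (Fin n) × ℝ => q y.2) z = 0 := by
    simp [gradInner, hq0]
  have hgrad2 : gradInner (fun y => ψ y * q y.2) (fun y => Real.exp (logHeatKernel n y)) z =
      -(q z.2 * Real.exp (logHeatKernel n z) *
        (∑ i, dirDeriv (spaceDir i) ψ z * z.1 i) * (2 * z.2)⁻¹) := by
    rw [gradInner, Finset.mul_sum, Finset.sum_mul, ← Finset.sum_neg_distrib]
    refine Finset.sum_congr rfl fun i _ => ?_
    rw [dirDeriv_mul (hψ.differentiable (by simp) z) (hqz.differentiable (by simp) z), hq0,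
      dirDeriv_exp (hg.differentiableAt (by simp)), dirDeriv_spaceDir_logHeatKernel hz]
    ring
  rw [heatFlow_mul (hψ.mul hqz).contDiffAt hg.exp, heatFlow_exp_logHeatKernel hz, hgrad2,
    heatFlow_mul hψ.contDiffAt hqz.contDiffAt, hqflow, hgrad]
  field_simp
  ring

theorem contDiff_cutoff_mul_heatKernel {ψ : EuclideanSpace ℝ (Fin n) × ℝ → ℝ} {q : ℝ → ℝ}
    (hψ : ContDiff ℝ 2 ψ) (hq : ContDiff ℝ 2 q) {ε : ℝ} (hε : 0 < ε) (hq0 : ∀ s ≤ ε, q s = 0) :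
    ContDiff ℝ 2 (fun y => ψ y * q y.2 * Real.exp (logHeatKernel n y)) := by
  refine contDiff_iff_contDiffAt.2 fun z => ?_
  rcases lt_or_ge 0 z.2 with hz | hz
  · exact (hψ.mul (hq.comp contDiff_snd)).contDiffAt.mul (contDiffAt_logHeatKernel hz).exp
  · have : (fun y => ψ y * q y.2 * Real.exp (logHeatKernel n y)) =ᶠ[nhds z] fun _ => 0 := by
      filter_upwards [continuous_snd.continuousAt.eventually
        (gt_mem_nhds (lt_of_le_of_lt hz hε))] with y hy
      simp [hq0 _ hy.le]
    exact contDiffAt_const.congr_of_eventuallyEq this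

theorem setIntegral_closedBall_prod_Icc_deriv (q : ℝ → ℝ) (hq : ContDiff ℝ 1 q) {r s t : ℝ}
    (hr : 0 < r) (hst : s ≤ t) :
    ∫ z in (Metric.closedBall (0 : EuclideanSpace ℝ (Fin n)) r) ×ˢ Icc s t, deriv q z.2 =
      r ^ n * volume.real (Metric.closedBall (0 : EuclideanSpace ℝ (Fin n)) 1) * (q t - q s) := by
  have h1 := setIntegral_prod_mul (μ := (volume : Measure (EuclideanSpace ℝ (Fin n))))
    (ν := (volume : Measure ℝ)) (fun _ => (1 : ℝ)) (deriv q) (Metric.closedBall 0 r) (Icc s t)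
  simp only [one_mul] at h1
  have h2 : ∫ u in Icc s t, deriv q u = q t - q s := by
    rw [integral_Icc_eq_integral_Ioc, ← intervalIntegral.integral_of_le hst]
    exact intervalIntegral.integral_deriv_eq_sub (fun u _ => hq.differentiable (by simp) u)
      (hq.continuous_deriv (by simp)).continuousOn.intervalIntegrable
  have h3 : volume.real (Metric.closedBall (0 : EuclideanSpace ℝ (Fin n)) r) =
      r ^ n * volume.real (Metric.closedBall (0 : EuclideanSpace ℝ (Fin n)) 1) := by
    rw [Measure.real, Measure.addHaar_closedBall' _ _ hr.le, ENNReal.toReal_mul,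
      ENNReal.toReal_ofReal (by positivity), finrank_euclideanSpace_fin, Measure.real]
  rw [h2, setIntegral_const, h3, smul_eq_mul, mul_one] at h1
  exact h1

/-- Cut the kernel off in space-time at unit scale and in time at scale r². The time cutoff yields
-ρ, a smeared point mass at the origin. The essential point is that `C` and `c` do not depend on
`δ`: on a box of spatial radius r the kernel is of order r^(-n), the spatial volume is of order r^n,
and q' integrates to 1. -/
theorem exists_test_function (n : ℕ) : ∃ C c : ℝ, 0 < C ∧ 0 < c ∧ ∀ δ : ℝ, 0 < δ →
    ∃ Φ ρ : EuclideanSpace ℝ (Fin n) × ℝ → ℝ, ContDiff ℝ 2 Φ ∧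
      tsupport Φ ⊆ Metric.closedBall 0 1 ∧ (∀ z, 0 ≤ Φ z) ∧ (∀ z, 0 ≤ ρ z) ∧ Integrable ρ ∧
      (∀ z, ρ z ≠ 0 → ‖z‖ < δ) ∧ c ≤ ∫ z, ρ z ∧
      ∀ z, heatFlow (-1) Φ z ≤ (Metric.closedBall 0 1).indicator (fun _ => C) z - ρ z := by
  let ψ : ContDiffBump (0 : EuclideanSpace ℝ (Fin n) × ℝ) := ⟨1 / 2, 1, by norm_num, by norm_num⟩
  have hψ : ContDiff ℝ 2 ψ := ψ.contDiff
  let G : EuclideanSpace ℝ (Fin n) × ℝ → ℝ := fun z => ∑ i, dirDeriv (spaceDir i) ψ z * z.1 i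
  have hG : Continuous G := continuous_finsetSum _ fun i _ =>
    (hψ.dirDeriv (m := 1) (by norm_num)).continuous.mul (by fun_prop)
  obtain ⟨C₁, hC₁⟩ := (isCompact_closedBall (0 : EuclideanSpace ℝ (Fin n) × ℝ)
    1).exists_bound_of_continuousOn (hψ.continuous_heatFlow (σ := -1)).continuousOn
  obtain ⟨C₂, hC₂⟩ := (isCompact_closedBall (0 : EuclideanSpace ℝ (Fin n) × ℝ)
    1).exists_bound_of_continuousOn hG.continuousOn
  have hC₁0 : 0 ≤ C₁ := (norm_nonneg _).trans (hC₁ 0 (by simp))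
  have hC₂0 : 0 ≤ C₂ := (norm_nonneg _).trans (hC₂ 0 (by simp))
  set K : ℝ := Real.exp ((n / 2 + 1 : ℝ) * Real.log (16 * (n / 2 + 1 : ℝ))) with hK
  set ω : ℝ := volume.real (Metric.closedBall (0 : EuclideanSpace ℝ (Fin n)) 1) with hω
  have hω0 : 0 < ω := ENNReal.toReal_pos
    (Metric.measure_closedBall_pos _ _ one_pos).ne' measure_closedBall_lt_top.ne
  refine ⟨(C₁ + C₂) * K + 1, Real.exp (-(n / 2 : ℝ) * Real.log 2 - 1 / 4) * ω, by positivity,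
    by positivity, fun δ hδ => ?_⟩
  -- The bound 1/4 places the box, of norm at most r, where `ψ` is 1, and gives 2r² ≤ r.
  obtain ⟨r, hr0, hrδ, hr1⟩ : ∃ r : ℝ, 0 < r ∧ r < δ ∧ r ≤ 1 / 4 :=
    ⟨min (δ / 2) (1 / 4), by positivity, (min_le_left _ _).trans_lt (by linarith),
      min_le_right _ _⟩
  have hr2 : 2 * r ^ 2 ≤ r := by nlinarith
  let q : ℝ → ℝ := fun s => Real.smoothTransition (s / r ^ 2 - 1)
  have hq : ContDiff ℝ 2 q := Real.smoothTransition.contDiff.comp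
    ((contDiff_id.div_const _).sub contDiff_const)
  have hqmono : Monotone q := fun s t hst => Real.smoothTransition.monotone (by gcongr)
  have hqd : ∀ s, 0 ≤ deriv q s := fun s => hqmono.deriv_nonneg
  have hq0 : ∀ s ≤ r ^ 2, q s = 0 := fun s hs => Real.smoothTransition.zero_of_nonpos
    (by rw [sub_nonpos, div_le_one (by positivity)]; exact hs)
  have hq2 : q (2 * r ^ 2) = 1 := Real.smoothTransition.one_of_one_le
    (by rw [mul_div_cancel_right₀ _ (by positivity)]; norm_num)
  set a : ℝ := Real.exp (-(n / 2 : ℝ) * Real.log (2 * r ^ 2) - 1 / 4) with ha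
  let box : Set (EuclideanSpace ℝ (Fin n) × ℝ) := Metric.closedBall 0 r ×ˢ Icc (r ^ 2) (2 * r ^ 2)
  have hbox : MeasurableSet box := measurableSet_closedBall.prod measurableSet_Icc
  have hboxc : IsCompact box := (isCompact_closedBall _ _).prod isCompact_Icc
  have hbox_norm : ∀ z ∈ box, ‖z‖ ≤ r := by
    intro z hz
    rw [Prod.norm_def, Real.norm_eq_abs, abs_of_pos (lt_of_lt_of_le (by positivity) hz.2.1)]
    exact max_le (mem_closedBall_zero_iff.1 hz.1) (hz.2.2.trans hr2)
  have hbox_kernel : ∀ z ∈ box, a ≤ Real.exp (logHeatKernel n z) := by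
    intro z hz
    have hz0 : 0 < z.2 := lt_of_lt_of_le (by positivity) hz.2.1
    have h1 : ‖z.1‖ ≤ r := mem_closedBall_zero_iff.1 hz.1
    have h2 : (n / 2 : ℝ) * Real.log z.2 ≤ (n / 2 : ℝ) * Real.log (2 * r ^ 2) :=
      mul_le_mul_of_nonneg_left (Real.log_le_log hz0 hz.2.2) (by positivity)
    have h3 : ‖z.1‖ ^ 2 * (4 * z.2)⁻¹ ≤ 1 / 4 := by
      rw [← div_eq_mul_inv, div_le_iff₀ (by positivity)]
      have : ‖z.1‖ ^ 2 ≤ r ^ 2 := by gcongr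
      linarith [hz.2.1]
    rw [ha, Real.exp_le_exp, logHeatKernel]
    linarith
  let ρ : EuclideanSpace ℝ (Fin n) × ℝ → ℝ := box.indicator fun z => a * deriv q z.2
  have hρ0 : ∀ z, 0 ≤ ρ z := indicator_nonneg fun z _ => mul_nonneg (Real.exp_pos _).le (hqd _)
  have hρc : Continuous fun z : EuclideanSpace ℝ (Fin n) × ℝ => a * deriv q z.2 :=
    continuous_const.mul ((hq.continuous_deriv (by norm_num)).comp continuous_snd)
  refine ⟨fun y => ψ y * q y.2 * Real.exp (logHeatKernel n y), ρ,
    contDiff_cutoff_mul_heatKernel hψ hq (by positivity) hq0, ?_, fun z => ?_, hρ0, ?_, ?_, ?_, ?_⟩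
  · have hsub := (tsupport_mul_subset_left (f := fun y => ψ y * q y.2)
      (g := fun y => Real.exp (logHeatKernel n y))).trans
      (tsupport_mul_subset_left (f := ψ) (g := fun y => q y.2))
    rwa [ψ.tsupport_eq] at hsub
  · exact mul_nonneg (mul_nonneg ψ.nonneg (Real.smoothTransition.nonneg _)) (Real.exp_pos _).le
  · exact (hρc.continuousOn.integrableOn_compact hboxc).integrable_indicator hbox
  · intro z hz
    exact (hbox_norm z (mem_of_indicator_ne_zero hz)).trans_lt hrδ
  · rw [integral_indicator hbox, integral_const_mul,
      setIntegral_closedBall_prod_Icc_deriv q (hq.of_le (by norm_num)) hr0 (by nlinarith), hq2,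
      hq0 _ le_rfl, sub_zero, mul_one, ← mul_assoc]
    refine le_of_eq ?_
    congr 1
    -- The powers of r cancel: r^n (2r²)^(-n/2) = 2^(-n/2).
    have hrn : r ^ n = Real.exp (n * Real.log r) := by
      rw [mul_comm, Real.exp_mul, Real.exp_log hr0, Real.rpow_natCast]
    rw [hrn, ha, ← Real.exp_add, Real.log_mul two_ne_zero (by positivity), Real.log_pow]
    congr 1
    push_cast
    ring
  · intro z
    have hind : 0 ≤ (Metric.closedBall (0 : EuclideanSpace ℝ (Fin n) × ℝ) 1).indicator
        (fun _ => (C₁ + C₂) * K + 1) z := indicator_nonneg (fun _ _ => by positivity) z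
    have hρz : z ∉ box → ρ z = 0 := fun h => indicator_of_notMem h _
    rcases le_or_gt z.2 0 with hz | hz
    · have h0 : (fun y => ψ y * q y.2 * Real.exp (logHeatKernel n y)) =ᶠ[nhds z] fun _ => 0 := by
        filter_upwards [continuous_snd.continuousAt.eventually
          (gt_mem_nhds (lt_of_le_of_lt hz (by positivity : 0 < r ^ 2)))] with y hy
        simp [hq0 _ hy.le]
      rw [heatFlow_congr h0, heatFlow_const, hρz fun h => absurd (h.2.1.trans hz)
        (not_le.2 (by positivity))]
      linarith
    rw [heatFlow_cutoff_mul_heatKernel hψ hq hz]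
    change q z.2 * (_ * (_ - G z * _)) - _ ≤ _
    have hdrop : 0 ≤ ψ z * Real.exp (logHeatKernel n z) * deriv q z.2 :=
      mul_nonneg (mul_nonneg ψ.nonneg (Real.exp_pos _).le) (hqd _)
    -- Inside radius 1/2 only the q' term remains; between 1/2 and 1 the kernel bound controls the
    -- cutoff error; beyond 1 everything vanishes.
    rcases lt_or_ge ‖z‖ (1 / 2) with hz2 | hz2
    · have hψ1 : ψ =ᶠ[nhds z] fun _ => 1 :=
        ψ.eventuallyEq_one_of_mem_ball (mem_ball_zero_iff.2 hz2)
      have hGz : G z = 0 := Finset.sum_eq_zero fun i _ => by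
        rw [dirDeriv_congr hψ1]; simp [dirDeriv]
      rw [heatFlow_congr hψ1, heatFlow_const, hGz]
      by_cases hzb : z ∈ box
      · have h1 : ρ z = a * deriv q z.2 := indicator_of_mem hzb _
        have h2 := mul_le_mul_of_nonneg_right (hbox_kernel z hzb) (hqd z.2)
        rw [h1, hψ1.eq_of_nhds]
        linarith
      · rw [hρz hzb]
        linarith
    · have hzb : z ∉ box := fun h => by linarith [hbox_norm z h]
      rw [hρz hzb]
      by_cases hz1 : z ∈ Metric.closedBall (0 : EuclideanSpace ℝ (Fin n) × ℝ) 1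
      · rw [indicator_of_mem hz1]
        have hs1 : z.2 ≤ 1 := (le_abs_self _).trans
          ((norm_snd_le z).trans (mem_closedBall_zero_iff.1 hz1))
        have hsinv : 1 ≤ z.2⁻¹ := (one_le_inv₀ hz).2 hs1
        have h1 := (abs_le.1 (hC₁ z hz1)).2
        have h2 := (abs_le.1 (hC₂ z hz1)).1
        have h3 : heatFlow (-1) ψ z - G z * z.2⁻¹ ≤ (C₁ + C₂) * z.2⁻¹ := by nlinarith
        have h4 : Real.exp (logHeatKernel n z) * (heatFlow (-1) ψ z - G z * z.2⁻¹) ≤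
            (C₁ + C₂) * K := by
          calc _ ≤ Real.exp (logHeatKernel n z) * ((C₁ + C₂) * z.2⁻¹) :=
                mul_le_mul_of_nonneg_left h3 (Real.exp_pos _).le
            _ = (C₁ + C₂) * (Real.exp (logHeatKernel n z) * z.2⁻¹) := by ring
            _ ≤ _ := mul_le_mul_of_nonneg_left (exp_logHeatKernel_div_le hz hz2) (by positivity)
        have h5 : q z.2 * (Real.exp (logHeatKernel n z) * (heatFlow (-1) ψ z - G z * z.2⁻¹)) ≤
            (C₁ + C₂) * K :=
          (mul_le_mul_of_nonneg_left h4 (Real.smoothTransition.nonneg _)).trans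
            (mul_le_of_le_one_left (by positivity) (Real.smoothTransition.le_one _))
        linarith
      · have hzt : z ∉ tsupport ψ := by rwa [ψ.tsupport_eq]
        have hGz : G z = 0 := Finset.sum_eq_zero fun i _ => by
          rw [dirDeriv_eq_zero_of_notMem_tsupport hzt, zero_mul]
        rw [heatFlow_eq_zero_of_notMem_tsupport hzt, hGz]
        linarith

end TestFunction

/-! ### The growth lemma at unit scale. -/

section Growth

variable {n : ℕ}

theorem tsupport_heatFlow_subset {σ : ℝ} {f : EuclideanSpace ℝ (Fin n) × ℝ → ℝ} :
    tsupport (heatFlow σ f) ⊆ tsupport f :=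
  closure_minimal (fun _ hz => by_contra fun h => hz (heatFlow_eq_zero_of_notMem_tsupport h))
    (isClosed_tsupport f)

theorem integrable_heatFlow_mul {σ : ℝ} {f g : EuclideanSpace ℝ (Fin n) × ℝ → ℝ}
    {U : Set (EuclideanSpace ℝ (Fin n) × ℝ)} (hU : IsOpen U) (hf : ContDiff ℝ 2 f)
    (hfc : HasCompactSupport f) (hfU : tsupport f ⊆ U) (hg : ContinuousOn g U) :
    Integrable fun z => heatFlow σ f z * g z :=
  integrable_mul_of_tsupport_subset hU hf.continuous_heatFlow
    (hfc.mono' (subset_closure.trans tsupport_heatFlow_subset))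
    (tsupport_heatFlow_subset.trans hfU) hg

/-- Put w = L^(2v), a subsolution. It is at least L² on the support of ρ, at most L where v ≤ 1/2,
and at most L⁴ throughout. Testing gives 0 ≤ CL|B| + CL⁴|A ∩ B| - cL², and for large L the first
term cannot balance the last. -/
theorem exists_volume_superlevel_ge (n : ℕ) : ∃ θ : ℝ, 0 < θ ∧
    ∀ v : EuclideanSpace ℝ (Fin n) × ℝ → ℝ, ContDiffOn ℝ 2 v (Metric.ball 0 2) →
      (∀ z ∈ Metric.ball 0 2, 0 ≤ heatFlow 1 v z) → (∀ z ∈ Metric.ball 0 2, v z ≤ 2) → 1 < v 0 →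
        ENNReal.ofReal θ ≤ volume (Metric.ball 0 2 ∩ {z | 1 / 2 < v z}) := by
  obtain ⟨C, c, hC, hc, htest⟩ := exists_test_function n
  set B : Set (EuclideanSpace ℝ (Fin n) × ℝ) := Metric.closedBall 0 1 with hB
  set U : Set (EuclideanSpace ℝ (Fin n) × ℝ) := Metric.ball 0 2 with hUdef
  have hU : IsOpen U := Metric.isOpen_ball
  have hBU : B ⊆ U := Metric.closedBall_subset_ball (by norm_num)
  have hBm : MeasurableSet B := measurableSet_closedBall
  have hBfin : volume B ≠ ⊤ := measure_closedBall_lt_top.ne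
  -- With this choice CL|B| = (L - 1)Lc/2 ≤ L²c/2, half of the negative term.
  set L : ℝ := 1 + 2 * C * volume.real B / c with hL
  have hL1 : 1 ≤ L := by
    have : 0 ≤ 2 * C * volume.real B / c := by positivity
    linarith
  have hL0 : 0 < L := by linarith
  have hlog : 0 ≤ Real.log L := Real.log_nonneg hL1
  refine ⟨c / (2 * C * L ^ 2), by positivity, fun v hv hvH hv2 hv0 => ?_⟩
  set w : EuclideanSpace ℝ (Fin n) × ℝ → ℝ := fun z => Real.exp (2 * Real.log L * v z) with hw
  have hpow : ∀ k : ℕ, Real.exp (k * Real.log L) = L ^ k := fun k => by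
    rw [mul_comm, Real.exp_mul, Real.exp_log hL0, Real.rpow_natCast]
  have hvw : ContDiffOn ℝ 2 (fun z => 2 * Real.log L * v z) U := contDiffOn_const.mul hv
  have hwU : ContDiffOn ℝ 2 w U := hvw.exp
  have hwH : ∀ z ∈ U, 0 ≤ heatFlow 1 w z := fun z hz => by
    have hz' := hU.mem_nhds hz
    rw [hw, heatFlow_exp (hvw.contDiffAt hz'), heatFlow_const_mul _ (hv.contDiffAt hz')]
    exact mul_nonneg (Real.exp_pos _).le
      (add_nonneg (mul_nonneg (by positivity) (hvH z hz)) gradInner_self_nonneg)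
  have h0U : (0 : EuclideanSpace ℝ (Fin n) × ℝ) ∈ U := Metric.mem_ball_self (by norm_num)
  -- This `δ` depends on `v`, which is why the test-function constants had to be uniform in it.
  obtain ⟨δ, hδ, hδv⟩ : ∃ δ > 0, ∀ z : EuclideanSpace ℝ (Fin n) × ℝ, ‖z‖ < δ → 1 < v z := by
    have := ((hv.continuousOn.continuousAt (hU.mem_nhds h0U)).eventually (lt_mem_nhds hv0))
    obtain ⟨δ, hδ, h⟩ := Metric.eventually_nhds_iff.1 this
    exact ⟨δ, hδ, fun z hz => h (by simpa using hz)⟩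
  obtain ⟨Φ, ρ, hΦ, hΦs, hΦ0, hρ0, hρi, hρs, hρc, hΦρ⟩ := htest δ hδ
  have hΦc : HasCompactSupport Φ :=
    (isCompact_closedBall _ _).of_isClosed_subset (isClosed_tsupport _) hΦs
  have hA : IsOpen (U ∩ {z | 1 / 2 < v z}) := hv.continuousOn.isOpen_inter_preimage hU isOpen_Ioi
  set A : Set (EuclideanSpace ℝ (Fin n) × ℝ) := U ∩ {z | 1 / 2 < v z} with hAdef
  have hABm : MeasurableSet (A ∩ B) := hA.measurableSet.inter hBm
  have hABfin : volume (A ∩ B) ≠ ⊤ := measure_ne_top_of_subset inter_subset_right hBfin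
  have hpos : 0 ≤ ∫ z, heatFlow (-1) Φ z * w z := by
    rw [← integral_mul_heatFlow hU hΦ hΦc (hΦs.trans hBU) hwU]
    refine integral_nonneg fun z => ?_
    by_cases hz : z ∈ tsupport Φ
    · exact mul_nonneg (hΦ0 z) (hwH z (hBU (hΦs hz)))
    · simp [image_eq_zero_of_notMem_tsupport hz]
  have hptw : ∀ z, heatFlow (-1) Φ z * w z ≤ B.indicator (fun _ => C * L) z +
      (A ∩ B).indicator (fun _ => C * L ^ 4) z - L ^ 2 * ρ z := by
    intro z
    have hw0 : 0 < w z := Real.exp_pos _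
    have h1 : heatFlow (-1) Φ z * w z ≤ (B.indicator (fun _ => C) z - ρ z) * w z :=
      mul_le_mul_of_nonneg_right (hΦρ z) hw0.le
    have h2 : L ^ 2 * ρ z ≤ ρ z * w z := by
      by_cases hρz : ρ z = 0
      · simp [hρz]
      · rw [mul_comm]
        refine mul_le_mul_of_nonneg_left ?_ (hρ0 z)
        rw [← hpow, hw]
        refine Real.exp_le_exp.2 ?_
        push_cast
        exact le_mul_of_one_le_right (by positivity) (hδv z (hρs z hρz)).le
    have h3 : B.indicator (fun _ => C) z * w z ≤ B.indicator (fun _ => C * L) z +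
        (A ∩ B).indicator (fun _ => C * L ^ 4) z := by
      by_cases hzB : z ∈ B
      · rw [indicator_of_mem hzB, indicator_of_mem hzB]
        by_cases hzA : z ∈ A
        · rw [indicator_of_mem (show z ∈ A ∩ B from ⟨hzA, hzB⟩)]
          have : w z ≤ L ^ 4 := by
            rw [← hpow, hw]
            refine Real.exp_le_exp.2 ?_
            push_cast
            nlinarith [hv2 z (hBU hzB)]
          have h4 := mul_le_mul_of_nonneg_left this hC.le
          have h5 : 0 ≤ C * L := by positivity
          linarith
        · have hv' : v z ≤ 1 / 2 := not_lt.1 fun h => hzA ⟨hBU hzB, h⟩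
          have : w z ≤ L ^ 1 := by
            rw [← hpow, hw]
            refine Real.exp_le_exp.2 ?_
            push_cast
            nlinarith
          have h4 := mul_le_mul_of_nonneg_left this hC.le
          rw [indicator_of_notMem fun h => hzA h.1]
          linarith
      · rw [indicator_of_notMem hzB, indicator_of_notMem hzB, indicator_of_notMem fun h => hzB h.2]
        simp
    linarith
  have i1 : Integrable (B.indicator fun _ => C * L) :=
    (integrableOn_const hBfin).integrable_indicator hBm
  have i2 : Integrable ((A ∩ B).indicator fun _ => C * L ^ 4) :=
    (integrableOn_const hABfin).integrable_indicator hABm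
  have hint := integral_mono (integrable_heatFlow_mul hU hΦ hΦc (hΦs.trans hBU) hwU.continuousOn)
    ((i1.add i2).sub (hρi.const_mul (L ^ 2))) hptw
  rw [integral_sub' (i1.add i2) (hρi.const_mul (L ^ 2)), integral_add' i1 i2,
    integral_indicator hBm, integral_indicator hABm, setIntegral_const, setIntegral_const,
    integral_const_mul, smul_eq_mul, smul_eq_mul] at hint
  have h1 : L ^ 2 * c ≤ L ^ 2 * ∫ z, ρ z := mul_le_mul_of_nonneg_left hρc (by positivity)
  have h2 : volume.real B * (C * L) = (L - 1) * L * c / 2 := by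
    rw [hL]; field_simp; ring
  have h3 : c / (2 * C * L ^ 2) ≤ volume.real (A ∩ B) := by
    rw [div_le_iff₀ (by positivity)]
    have h4 : L ^ 2 * (c / 2) ≤ L ^ 2 * (volume.real (A ∩ B) * (C * L ^ 2)) := by
      nlinarith [mul_pos hL0 hc]
    have := le_of_mul_le_mul_left h4 (by positivity)
    linarith
  calc ENNReal.ofReal (c / (2 * C * L ^ 2)) ≤ ENNReal.ofReal (volume.real (A ∩ B)) :=
        ENNReal.ofReal_le_ofReal h3
    _ = volume (A ∩ B) := ENNReal.ofReal_toReal hABfin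
    _ ≤ volume A := measure_mono inter_subset_left

end Growth

/-! ### Upper bound by the doubling argument. -/

section SupBound

variable {n : ℕ}

theorem exists_volume_superlevel_ge_of_ball (n : ℕ) : ∃ θ : ℝ, 0 < θ ∧
    ∀ (u : EuclideanSpace ℝ (Fin n) × ℝ → ℝ) (U : Set (EuclideanSpace ℝ (Fin n) × ℝ))
      (a : EuclideanSpace ℝ (Fin n) × ℝ) (r M : ℝ), IsOpen U → ContDiffOn ℝ 2 u U →
      (∀ z ∈ U, 0 ≤ heatFlow (-1) u z) → 0 < r → r ≤ 1 → 0 < M → Metric.ball a (r * 2) ⊆ U →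
      M < u a → (∀ z ∈ Metric.ball a (r * 2), u z ≤ 2 * M) →
        ENNReal.ofReal (r ^ (n + 2) * θ) ≤ volume (U ∩ {z | M / 2 < u z}) := by
  obtain ⟨θ, hθ, H⟩ := exists_volume_superlevel_ge n
  refine ⟨θ, hθ, fun u U a r M hU hu huH hr hr1 hM hball hMa h2M => ?_⟩
  have hT : ∀ z ∈ Metric.ball (0 : EuclideanSpace ℝ (Fin n) × ℝ) 2,
      a + parabolicScaling n r z ∈ Metric.ball a (r * 2) := fun z hz =>
    (dist_add_parabolicScaling_le hr.le hr1 a z).trans_lt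
      (mul_lt_mul_of_pos_left (mem_ball_zero_iff.1 hz) hr)
  have hvT : ContDiffOn ℝ 2 (fun z => u (a + parabolicScaling n r z)) (Metric.ball 0 2) :=
    hu.comp (contDiff_const.add (parabolicScaling n r).contDiff).contDiffOn
      fun z hz => hball (hT z hz)
  have h := H (fun z => M⁻¹ * u (a + parabolicScaling n r z)) (contDiffOn_const.mul hvT)
    (fun z hz => ?_) (fun z hz => ?_) ?_
  · calc ENNReal.ofReal (r ^ (n + 2) * θ)
        = ENNReal.ofReal (|r| ^ (n + 2)) * ENNReal.ofReal θ := by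
          rw [abs_of_pos hr, ENNReal.ofReal_mul (by positivity)]
      _ ≤ _ := mul_le_mul_right h _
      _ = _ := (volume_image_parabolicScaling r a _).symm
      _ ≤ _ := measure_mono ?_
    rintro _ ⟨z, ⟨hz, hz'⟩, rfl⟩
    refine ⟨hball (hT z hz), ?_⟩
    have hz2 : 1 / 2 < M⁻¹ * u (a + parabolicScaling n r z) := hz'
    rw [inv_mul_eq_div, lt_div_iff₀ hM] at hz2
    change M / 2 < u (a + parabolicScaling n r z)
    linarith
  · rw [heatFlow_const_mul _ (hvT.contDiffAt (Metric.isOpen_ball.mem_nhds hz)),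
      heatFlow_comp_parabolicScaling r a
        (hu.contDiffAt (hU.mem_nhds (hball (hT z hz))))]
    exact mul_nonneg (inv_nonneg.2 hM.le) (mul_nonneg (sq_nonneg r) (huH _ (hball (hT z hz))))
  · rw [inv_mul_le_iff₀ hM, mul_comm]
    exact h2M _ (hT z hz)
  · rw [map_zero, add_zero, inv_mul_eq_div, one_lt_div hM]
    exact hMa

theorem exists_le_of_volume_abs_ge_le (n : ℕ) {p R κ : ℝ} (hp : 0 < p) (hR : 0 < R)
    (hκ : 0 < κ) : ∃ c : ℝ, 0 < c ∧
    ∀ (u : EuclideanSpace ℝ (Fin n) × ℝ → ℝ) (a : EuclideanSpace ℝ (Fin n) × ℝ),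
      ContDiffOn ℝ 2 u (Metric.ball a R) → (∀ z ∈ Metric.ball a R, 0 ≤ heatFlow (-1) u z) →
      (∀ ε : ℝ, 0 < ε →
        volume (Metric.ball a R ∩ {z | ε ≤ |u z|}) ≤ ENNReal.ofReal ((c / ε) ^ p)) →
        ∀ z ∈ Metric.closedBall a (R / 2), u z ≤ κ := by
  obtain ⟨θ, hθ, H⟩ := exists_volume_superlevel_ge_of_ball n
  -- Chosen so that q^(n+2) = 2^(-p): doubling the height shrinks the Chebyshev bound and the
  -- parabolic volume by the same factor.
  set q : ℝ := (2 : ℝ) ^ (-p / (n + 2 : ℕ)) with hq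
  have hq0 : 0 < q := by positivity
  have hq1 : q < 1 := Real.rpow_lt_one_of_one_lt_of_neg one_lt_two
    (div_neg_of_neg_of_pos (neg_lt_zero.2 hp) (by positivity))
  have hqn : q ^ (n + 2) = (2 : ℝ) ^ (-p) := by
    rw [hq, ← Real.rpow_natCast, ← Real.rpow_mul zero_le_two]
    congr 1
    field_simp
  have hq1' : 0 < 1 - q := sub_pos.2 hq1
  -- The steps 2ρq^j then add up to at most R/4, keeping all points within 3R/4 of the centre.
  obtain ⟨ρ, hρ0, hρ1, hρR⟩ : ∃ ρ : ℝ, 0 < ρ ∧ ρ ≤ 1 ∧ 2 * ρ / (1 - q) ≤ R / 4 :=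
    ⟨min 1 (R * (1 - q) / 8), by positivity, min_le_left _ _, by
      rw [div_le_iff₀ hq1']
      linarith [min_le_right 1 (R * (1 - q) / 8)]⟩
  set b : ℝ := θ * ρ ^ (n + 2) / 2 with hb
  have hb0 : 0 < b := by positivity
  -- At height 2^k κ/2 the volume bound becomes b 2^(-kp), half of the growth lemma's θ(ρq^k)^(n+2);
  -- hence the contradiction at every stage.
  refine ⟨κ / 2 * b ^ p⁻¹, by positivity, fun u a hu huH hvol z hz => ?_⟩
  by_contra! hlt
  have hgeom : ∀ k : ℕ, 2 * ρ * ∑ j ∈ Finset.range k, q ^ j ≤ R / 4 := fun k => by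
    have h1 : ∑ j ∈ Finset.range k, q ^ j ≤ (1 - q)⁻¹ := by
      rw [← tsum_geometric_of_lt_one hq0.le hq1]
      exact (summable_geometric_of_lt_one hq0.le hq1).sum_le_tsum _ fun j _ => by positivity
    calc _ ≤ 2 * ρ * (1 - q)⁻¹ := mul_le_mul_of_nonneg_left h1 (by positivity)
      _ ≤ R / 4 := by rwa [← div_eq_mul_inv]
  have key : ∀ k : ℕ, ∃ y, dist y a ≤ R / 2 + 2 * ρ * ∑ j ∈ Finset.range k, q ^ j ∧
      2 ^ k * κ < u y := by
    intro k
    induction k with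
    | zero => exact ⟨z, by simpa using hz, by simpa using hlt⟩
    | succ k ih =>
      obtain ⟨y, hya, hy⟩ := ih
      have hqk : q ^ k ≤ 1 := pow_le_one₀ hq0.le hq1.le
      have hr0 : 0 < ρ * q ^ k := by positivity
      have hr1 : ρ * q ^ k ≤ 1 := mul_le_one₀ hρ1 (by positivity) hqk
      have hsum := hgeom (k + 1)
      rw [Finset.sum_range_succ, mul_add] at hsum
      by_contra! hno
      have hball : ∀ x ∈ Metric.ball y (ρ * q ^ k * 2),
          dist x a ≤ R / 2 + 2 * ρ * ∑ j ∈ Finset.range (k + 1), q ^ j := fun x hx => by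
        rw [Finset.sum_range_succ, mul_add]
        have h1 := dist_triangle x y a
        have h2 : dist x y < ρ * q ^ k * 2 := hx
        linarith
      have hsub : Metric.ball y (ρ * q ^ k * 2) ⊆ Metric.ball a R := fun x hx => by
        have h1 := hball x hx
        have h2 := hgeom (k + 1)
        exact Metric.mem_ball.2 (by linarith)
      have hge := H u (Metric.ball a R) y (ρ * q ^ k) (2 ^ k * κ) Metric.isOpen_ball hu huH hr0 hr1
        (by positivity) hsub hy fun x hx => by
          have := hno x (hball x hx)
          rw [pow_succ] at this
          linarith
      have hle := hvol (2 ^ k * κ / 2) (by positivity)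
      have hmono : volume (Metric.ball a R ∩ {z | 2 ^ k * κ / 2 < u z}) ≤
          volume (Metric.ball a R ∩ {z | 2 ^ k * κ / 2 ≤ |u z|}) :=
        measure_mono (inter_subset_inter_right _ fun x hx => by
          have hx' : 2 ^ k * κ / 2 < u x := hx
          exact (hx'.le.trans (le_abs_self (u x)) : 2 ^ k * κ / 2 ≤ |u x|))
      have hle' := (ENNReal.ofReal_le_ofReal_iff (by positivity)).1 (hge.trans (hmono.trans hle))
      have e1 : κ / 2 * b ^ p⁻¹ / (2 ^ k * κ / 2) = b ^ p⁻¹ * (2 ^ k)⁻¹ := by field_simp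
      have e2 : (b ^ p⁻¹ * (2 ^ k)⁻¹) ^ p = b * (q ^ k) ^ (n + 2) := by
        rw [Real.mul_rpow (by positivity) (by positivity), ← Real.rpow_mul hb0.le,
          inv_mul_cancel₀ hp.ne', Real.rpow_one, ← pow_mul, mul_comm k, pow_mul, hqn,
          Real.inv_rpow (by positivity), ← Real.rpow_natCast 2 k, ← Real.rpow_mul zero_le_two,
          mul_comm (k : ℝ), Real.rpow_mul zero_le_two, Real.rpow_natCast,
          Real.rpow_neg zero_le_two, inv_pow]
      rw [e1, e2, mul_pow, hb] at hle'
      have : 0 < θ * ρ ^ (n + 2) * (q ^ k) ^ (n + 2) := by positivity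
      linarith
  obtain ⟨D, hD⟩ := (isCompact_closedBall a (3 * R / 4)).exists_bound_of_continuousOn
    (hu.continuousOn.mono (Metric.closedBall_subset_ball (by linarith)))
  obtain ⟨k, hk⟩ := pow_unbounded_of_one_lt (D / κ) one_lt_two
  obtain ⟨y, hya, hy⟩ := key k
  have h1 := hD y (Metric.mem_closedBall.2 (by linarith [hgeom k]))
  rw [div_lt_iff₀ hκ] at hk
  linarith [le_abs_self (u y), Real.norm_eq_abs (u y)]

/-! ### Lower bound for the volume where |u| is not small. -/

theorem exists_volume_abs_ge (a : EuclideanSpace ℝ (Fin n) × ℝ) {R : ℝ} (hR : 0 < R) :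
    ∃ κ b : ℝ, 0 < κ ∧ 0 < b ∧ ∀ u : EuclideanSpace ℝ (Fin n) × ℝ → ℝ,
      ContDiffOn ℝ 2 u (Metric.ball a R) → (∀ z ∈ Metric.ball a R, 1 ≤ heatFlow (-1) u z) →
      (∀ z ∈ Metric.ball a R, u z ≤ κ) →
        ENNReal.ofReal b ≤ volume (Metric.ball a R ∩ {z | κ ≤ |u z|}) := by
  let φ : ContDiffBump a := ⟨R / 4, R / 2, by linarith, by linarith⟩
  have hφ : ContDiff ℝ 2 φ := φ.contDiff
  have hφU : tsupport φ ⊆ Metric.ball a R := by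
    rw [φ.tsupport_eq]; exact Metric.closedBall_subset_ball (by change R / 2 < R; linarith)
  have hφi : Integrable φ := φ.continuous.integrable_of_hasCompactSupport φ.hasCompactSupport
  have hI : 0 < ∫ z, φ z := φ.integral_pos
  obtain ⟨D, hD⟩ := (isCompact_closedBall a R).exists_bound_of_continuousOn
    (hφ.continuous_heatFlow (σ := 1)).continuousOn
  have hD0 : 0 ≤ D := (norm_nonneg _).trans (hD a (Metric.mem_closedBall_self hR.le))
  set U := Metric.ball a R with hUdef
  have hU : IsOpen U := Metric.isOpen_ball
  have hUfin : volume U ≠ ⊤ := measure_ball_lt_top.ne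
  set I : ℝ := Real.exp (-1) * ∫ z, φ z with hIdef
  have hI0 : 0 < I := by positivity
  -- The contribution of {|u| < κ} must use up at most half of `I`; the rest, I/2 ≤ (1 + 3D)|K|,
  -- gives the volume.
  obtain ⟨κ, hκ, hκ1, hκI⟩ : ∃ κ : ℝ, 0 < κ ∧ κ ≤ 1 ∧ 2 * D * volume.real U * κ ≤ I / 2 := by
    have hV : 0 ≤ 2 * D * volume.real U := by positivity
    refine ⟨min 1 (I / 2 / (2 * D * volume.real U + 1)), by positivity, min_le_left _ _, ?_⟩
    calc _ ≤ (2 * D * volume.real U) * (I / 2 / (2 * D * volume.real U + 1)) :=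
          mul_le_mul_of_nonneg_left (min_le_right _ _) hV
      _ ≤ I / 2 := by
          rw [mul_div_assoc', div_le_iff₀ (by positivity)]
          nlinarith
  refine ⟨κ, I / 2 / (1 + 3 * D), hκ, by positivity, fun u hu huH huκ => ?_⟩
  have hKm : MeasurableSet (U ∩ {z | κ ≤ |u z|}) := by
    have h1 : IsOpen (U ∩ u ⁻¹' {s | |s| < κ}) :=
      hu.continuousOn.isOpen_inter_preimage hU (isOpen_lt continuous_abs continuous_const)
    have h2 : U ∩ {z | κ ≤ |u z|} = U \ (U ∩ u ⁻¹' {s | |s| < κ}) := by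
      ext z; simp
    rw [h2]
    exact hU.measurableSet.diff h1.measurableSet
  set K := U ∩ {z | κ ≤ |u z|} with hK
  have hKfin : volume K ≠ ⊤ := measure_ne_top_of_subset inter_subset_left hUfin
  have heu : ContDiffOn ℝ 2 (fun z => Real.exp (u z)) U := hu.exp
  have hIBP := integral_mul_heatFlow (σ := -1) hU hφ φ.hasCompactSupport hφU heu
  -- Testing the constant 1 shows that the adjoint applied to `φ` has integral 0, so e^u may be
  -- replaced by e^u - 1, which is small off `K`.
  have hIBP1 := integral_mul_heatFlow (σ := -1) hU hφ φ.hasCompactSupport hφU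
    (contDiffOn_const (c := (1 : ℝ)))
  simp only [heatFlow_const, mul_zero, integral_zero, neg_neg] at hIBP hIBP1
  have j1 : Integrable fun z => heatFlow 1 φ z * Real.exp (u z) :=
    integrable_heatFlow_mul hU hφ φ.hasCompactSupport hφU heu.continuousOn
  have j2 : Integrable fun z => heatFlow 1 φ z * (1 : ℝ) :=
    integrable_heatFlow_mul hU hφ φ.hasCompactSupport hφU continuousOn_const
  have j3 : Integrable fun z => φ z * heatFlow (-1) (fun y => Real.exp (u y)) z :=
    integrable_mul_of_tsupport_subset hU hφ.continuous φ.hasCompactSupport hφU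
      (heu.continuousOn_heatFlow hU)
  have jU : Integrable (U.indicator fun _ => 2 * D * κ) :=
    (integrableOn_const hUfin).integrable_indicator hU.measurableSet
  have jK : Integrable (K.indicator fun _ => 3 * D) :=
    (integrableOn_const hKfin).integrable_indicator hKm
  have jK1 : Integrable (K.indicator fun _ => (1 : ℝ)) :=
    (integrableOn_const hKfin).integrable_indicator hKm
  have hlower : ∀ z, Real.exp (-1) * φ z - K.indicator (fun _ => (1 : ℝ)) z ≤
      φ z * heatFlow (-1) (fun y => Real.exp (u y)) z := by
    intro z
    have hK0 : 0 ≤ K.indicator (fun _ => (1 : ℝ)) z := indicator_nonneg (fun _ _ => zero_le_one) z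
    by_cases hz : z ∈ tsupport φ
    · have hzU := hφU hz
      have h1 : Real.exp (u z) ≤ heatFlow (-1) (fun y => Real.exp (u y)) z := by
        rw [heatFlow_exp (hu.contDiffAt (hU.mem_nhds hzU))]
        exact le_mul_of_one_le_right (Real.exp_pos _).le
          (le_add_of_le_of_nonneg (huH z hzU) gradInner_self_nonneg)
      have h2 := mul_le_mul_of_nonneg_left h1 (φ.nonneg (x := z))
      have h3 : 0 ≤ φ z * Real.exp (u z) := mul_nonneg φ.nonneg (Real.exp_pos _).le
      by_cases hzK : z ∈ K
      · rw [indicator_of_mem hzK]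
        have h4 : Real.exp (-1) * φ z ≤ 1 :=
          mul_le_one₀ (Real.exp_le_one_iff.2 (by norm_num)) φ.nonneg φ.le_one
        linarith
      · have h4 : |u z| < κ := not_le.1 fun h => hzK ⟨hzU, h⟩
        have h5 : Real.exp (-1) ≤ Real.exp (u z) :=
          Real.exp_le_exp.2 (by linarith [(abs_lt.1 h4).1])
        have h6 := mul_le_mul_of_nonneg_right h5 (φ.nonneg (x := z))
        linarith
    · rw [image_eq_zero_of_notMem_tsupport hz]
      linarith
  have hupper : ∀ z, heatFlow 1 φ z * Real.exp (u z) - heatFlow 1 φ z * 1 ≤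
      U.indicator (fun _ => 2 * D * κ) z + K.indicator (fun _ => 3 * D) z := by
    intro z
    by_cases hzU : z ∈ U
    · rw [indicator_of_mem hzU, ← mul_sub]
      have hDz := hD z (Metric.ball_subset_closedBall hzU)
      have h0 : heatFlow 1 φ z * (Real.exp (u z) - 1) ≤ D * |Real.exp (u z) - 1| := by
        refine (le_abs_self _).trans ?_
        rw [abs_mul]
        exact mul_le_mul_of_nonneg_right hDz (abs_nonneg _)
      by_cases hzK : z ∈ K
      · rw [indicator_of_mem hzK]
        have h1 : |Real.exp (u z) - 1| ≤ 3 := by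
          have h2 : Real.exp (u z) ≤ Real.exp 1 := Real.exp_le_exp.2 ((huκ z hzU).trans hκ1)
          rw [abs_le]
          exact ⟨by linarith [Real.exp_pos (u z)], by linarith [Real.exp_one_lt_d9]⟩
        have h3 := mul_le_mul_of_nonneg_left h1 hD0
        have h4 : 0 ≤ 2 * D * κ := by positivity
        linarith
      · rw [indicator_of_notMem hzK]
        have h4 : |u z| < κ := not_le.1 fun h => hzK ⟨hzU, h⟩
        have h1 : |Real.exp (u z) - 1| ≤ 2 * κ :=
          (Real.abs_exp_sub_one_le (by linarith)).trans (by linarith)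
        have h3 := mul_le_mul_of_nonneg_left h1 hD0
        linarith
    · rw [heatFlow_eq_zero_of_notMem_tsupport fun h => hzU (hφU h), indicator_of_notMem hzU,
        indicator_of_notMem fun h : z ∈ K => hzU h.1]
      simp
  have k1 := integral_mono ((hφi.const_mul _).sub jK1) j3 hlower
  have k2 := integral_mono (j1.sub j2) (jU.add jK) hupper
  rw [integral_sub' (hφi.const_mul _) jK1, integral_const_mul, integral_indicator hKm,
    setIntegral_const, smul_eq_mul, mul_one] at k1
  rw [integral_sub' j1 j2, integral_add' jU jK, integral_indicator hKm,
    integral_indicator hU.measurableSet, setIntegral_const, setIntegral_const, smul_eq_mul,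
    smul_eq_mul, ← hIBP1, ← hIBP] at k2
  have h3 : I / 2 / (1 + 3 * D) ≤ volume.real K := by
    rw [div_le_iff₀ (by positivity)]
    linarith
  exact (ENNReal.ofReal_le_ofReal h3).trans (ENNReal.ofReal_toReal hKfin).le

end SupBound

/-! ### Chebyshev's inequality and conclusion. -/

theorem measure_abs_ge_le_of_eLpNorm_le {α : Type*} [MeasurableSpace α] {μ : Measure α}
    {u : α → ℝ} (hu : AEStronglyMeasurable u μ) {p c ε : ℝ} (hp : 0 < p) (hc : 0 ≤ c)
    (hε : 0 < ε) (h : eLpNorm u (ENNReal.ofReal p) μ ≤ ENNReal.ofReal c) :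
    μ {z | ε ≤ |u z|} ≤ ENNReal.ofReal ((c / ε) ^ p) := by
  have hset : {z | ε ≤ |u z|} = {z | ENNReal.ofReal ε ≤ ‖u z‖ₑ} := by
    ext z
    rw [mem_ofPred_eq, mem_ofPred_eq, Real.enorm_eq_ofReal_abs,
      ENNReal.ofReal_le_ofReal_iff (abs_nonneg _)]
  have hm := meas_ge_le_mul_pow_eLpNorm_enorm μ (p := ENNReal.ofReal p)
    (ENNReal.ofReal_pos.2 hp).ne' ENNReal.ofReal_ne_top hu (ENNReal.ofReal_pos.2 hε).ne'
    (fun h => absurd h ENNReal.ofReal_ne_top)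
  rw [ENNReal.toReal_ofReal hp.le] at hm
  calc μ {z | ε ≤ |u z|} ≤ (ENNReal.ofReal ε)⁻¹ ^ p * eLpNorm u (ENNReal.ofReal p) μ ^ p := by
        rw [hset]; exact hm
    _ ≤ (ENNReal.ofReal ε)⁻¹ ^ p * ENNReal.ofReal c ^ p := by gcongr
    _ = ENNReal.ofReal ((c / ε) ^ p) := by
        rw [← ENNReal.mul_rpow_of_nonneg _ _ hp.le, mul_comm, ← div_eq_mul_inv,
          ← ENNReal.ofReal_div_of_pos hε, ENNReal.ofReal_rpow_of_nonneg (by positivity) hp.le]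

theorem mainTheorem2 (n : ℕ) (Ω : Set (EuclideanSpace ℝ (Fin n) × ℝ))
    (hΩ_open : IsOpen Ω) (hΩ_bdd : Bornology.IsBounded Ω) (hΩ_ne : Ω.Nonempty)
    (p : ℝ) (hp : p ∈ Ioo (0 : ℝ) 1) :
    ∃ c : ℝ, 0 < c ∧ ∀ u : EuclideanSpace ℝ (Fin n) × ℝ → ℝ,
      ContDiffOn ℝ 2 u Ω → (∀ z ∈ Ω, 1 ≤ heatOperator u z) →
        ENNReal.ofReal c ≤ eLpNorm u (ENNReal.ofReal p) (volume.restrict Ω) := by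
  obtain ⟨a, ha⟩ := hΩ_ne
  obtain ⟨R, hR, hRΩ⟩ := Metric.isOpen_iff.1 hΩ_open a ha
  have hR2 : 0 < R / 2 := by linarith
  have hp0 := hp.1
  obtain ⟨κ, b, hκ, hb, hlow⟩ := exists_volume_abs_ge a hR2
  obtain ⟨c₁, hc₁, hsup⟩ := exists_le_of_volume_abs_ge_le n hp0 hR hκ
  -- Chebyshev at height `κ` then gives volume at most b/2, against the lower bound `b`.
  set c₂ : ℝ := κ * (b / 2) ^ p⁻¹ with hc₂
  have hc₂0 : 0 < c₂ := by positivity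
  refine ⟨min c₁ c₂, lt_min hc₁ hc₂0, fun u hu huH => ?_⟩
  by_contra! hlt
  have hheat : ∀ z ∈ Metric.ball a R, 1 ≤ heatFlow (-1) u z := fun z hz => by
    rw [← heatOperator_eq_heatFlow (hu.contDiffAt (hΩ_open.mem_nhds (hRΩ hz)))]
    exact huH z (hRΩ hz)
  have huR : ContDiffOn ℝ 2 u (Metric.ball a R) := hu.mono hRΩ
  have hm : AEStronglyMeasurable u (volume.restrict Ω) :=
    hu.continuousOn.aestronglyMeasurable hΩ_open.measurableSet
  have hvol : ∀ c', min c₁ c₂ ≤ c' → ∀ ε : ℝ, 0 < ε →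
      volume (Metric.ball a R ∩ {z | ε ≤ |u z|}) ≤ ENNReal.ofReal ((c' / ε) ^ p) := by
    intro c' hc' ε hε
    have h1 := measure_abs_ge_le_of_eLpNorm_le hm hp0
      ((lt_min hc₁ hc₂0).le.trans hc') hε (hlt.le.trans (ENNReal.ofReal_le_ofReal hc'))
    rw [Measure.restrict_apply' hΩ_open.measurableSet] at h1
    exact (measure_mono fun z hz => And.intro hz.2 (hRΩ hz.1)).trans h1
  have hle := hsup u a huR (fun z hz => zero_le_one.trans (hheat z hz))
    (hvol c₁ (min_le_left _ _))
  have hsub : Metric.ball a (R / 2) ⊆ Metric.ball a R := Metric.ball_subset_ball (by linarith)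
  have hge := hlow u (huR.mono hsub) (fun z hz => hheat z (hsub hz))
    fun z hz => hle z (Metric.ball_subset_closedBall hz)
  have hfin := (hge.trans (measure_mono (inter_subset_inter_left _ hsub))).trans
    (hvol c₂ (min_le_right _ _) κ hκ)
  have hval : (c₂ / κ) ^ p = b / 2 := by
    rw [hc₂, mul_div_cancel_left₀ _ hκ.ne', ← Real.rpow_mul (by positivity),
      inv_mul_cancel₀ hp0.ne', Real.rpow_one]
  rw [hval, ENNReal.ofReal_le_ofReal_iff (by positivity)] at hfin
  linarith
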